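/- Let $G=(V,E)$ be a finite simple graph with $n\ge 1$ vertices and adjacency matrix $A$, let $\lambda_1\ge\cdots\ge\lambda_n$ be the eigenvalues of $A$ with multiplicity, let $k\ge 1$ be an integer, and let $p\in\mathbb{R}[x]$ have degree at most $k$. Put $W(p)=\max_{u\in V}(p(A))_{uu}$ and $w(p)=\min_{u\in V}(p(A))_{uu}$. A quantum $k$-distance $c$-coloring of $G$ by (possibly infinite-dimensional) projectors is a family of orthogonal projectors $\{P_{v,h}: v\in V,\ h\in\{1,\dots,c\}\}$ on a complex Hilbert space $H$ of arbitrary dimension, such that 1. $\sum_{h=1}^{c}P_{v,h}=I$ for every $v\in V$; 2. $P_{v,h}P_{w,h}=0$ for every $h$ and all distinct $v,w\in V$ at distance at most $k$ in $G$; 3. the unital $*$-algebra generated by the $P_{v,h}$ has a tracial state, that is, a linear functional $\tau$ with $\tau(I)=1$, $\tau(x^*x)\ge 0$ and $\tau(xy)=\tau(yx)$ for all $x,y$ in it. (If $0<\dim H<\infty$, condition 3 holds automatically, by the normalized trace.) Let $\chi_{kq}(G)$ be the smallest $c$ for which such a coloring exists on some $H$. Then the denominator below is positive and $$\chi_{kq}(G)\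 \ge\ \frac{n}{\min\{\,|\{i: p(\lambda_i)\ge w(p)\}|,\ |\{i: p(\lambda_i)\le W(p)\}|\,\}}.$$ -/

import Mathlib

/-!
The bound is Sylvester's inertia argument carried out under a trace. Let `B` be `p(A) - w(p)` or
`W(p) - p(A)`, and let `F` be the spectral projection of `B` for `[0, ∞)`. For a fixed color, let
`P` be the diagonal matrix whose entries are the projectors of the color class. As `B` vanishes
beyond distance `k` and has nonnegative diagonal, `P B P ≥ 0`. On the other hand, after rescaling,
`B ≤ C F - (1 - F)`. So `1 - F` is bounded by `C F` on the range of `P`, and the trace of `P` is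
at most that of `F`, which is the number of nonnegative eigenvalues of `B`. Summing over the colors
bounds `n` by `c` times this number.

The range of `P` embeds into that of `F`, but the generated `*`-algebra need not contain the
polar part of `F P`, so the traces are compared through words: the difference between the traces of
`(F (1 - P))^m F` and `(P (1 - F))^m P` does not depend on `m`. Both are nonnegative, since an
alternating word of odd length in projections is a hermitian square, and the second tends to `0`
geometrically.
-/

universe u v

open scoped ComplexOrder in
/-- A tracial state on a unital complex `*`-algebra: a linear functional that is positive,
takes the value `1` at the unit, and is invariant under cyclic permutations. On the algebra of
`d × d` matrices it is the normalized trace. -/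
structure IsTracialState {A : Type*} [Ring A] [StarRing A] [Algebra ℂ A] (τ : A →ₗ[ℂ] ℂ) :
    Prop where
  map_one : τ 1 = 1
  nonneg : ∀ x : A, 0 ≤ τ (star x * x)
  comm : ∀ x y : A, τ (x * y) = τ (y * x)

/-- A quantum `k`-distance `c`-coloring of `G` by orthogonal projectors on a complex Hilbert space
`H` of arbitrary, possibly infinite, dimension. In the matrix case `H = ℂ^d` the field
`tracial` holds automatically, by the normalized trace; in infinite dimension it is
the condition of the commuting operator (tracial) framework. It is required only on the unital
`*`-algebra generated by the projectors. -/
structure IsQuantumDistColoring {V : Type v} (G : SimpleGraph V) (k c : ℕ)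
    {H : Type u} [NormedAddCommGroup H] [InnerProductSpace ℂ H] [CompleteSpace H]
    (P : V → Fin c → (H →L[ℂ] H)) : Prop where
  proj : ∀ x h, IsStarProjection (P x h)
  complete : ∀ x, ∑ h, P x h = 1
  orthogonal : ∀ x y, x ≠ y → G.edist x y ≤ k → ∀ h, P x h * P y h = 0
  tracial : ∃ τ : StarAlgebra.adjoin ℂ {T : H →L[ℂ] H | ∃ x h, T = P x h} →ₗ[ℂ] ℂ,
    IsTracialState τ

/-- `G` admits a quantum `k`-distance `c`-coloring on some Hilbert space. The space is nonzero
since a tracial state takes the value `1` at the identity. -/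
def HasQuantumDistColoring {V : Type v} (G : SimpleGraph V) (k c : ℕ) : Prop :=
  ∃ (H : Type u) (_ : NormedAddCommGroup H) (_ : InnerProductSpace ℂ H) (_ : CompleteSpace H)
    (P : V → Fin c → (H →L[ℂ] H)), IsQuantumDistColoring G k c P

/-- The quantum `k`-distance chromatic number over Hilbert spaces of arbitrary dimension: the
least `c` for which a quantum `k`-distance `c`-coloring exists. -/
noncomputable def quantumDistChromaticNumber {V : Type v} (G : SimpleGraph V) (k : ℕ) : ℕ :=
  sInf {c : ℕ | HasQuantumDistColoring.{u} G k c}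

section Spectral

variable {V : Type v} [Fintype V] [DecidableEq V] (G : SimpleGraph V) [DecidableRel G.Adj]

/-- The eigenvalues of the adjacency matrix, listed with multiplicity. -/
noncomputable def adjEigenvalues : V → ℝ :=
  Matrix.IsHermitian.eigenvalues (A := G.adjMatrix ℝ)
    ((Matrix.conjTranspose_eq_transpose_of_trivial _).trans G.transpose_adjMatrix)

/-- `W(p)`, the largest diagonal entry of `p(A)`. -/
noncomputable def maxDiag (p : Polynomial ℝ) : ℝ :=
  ⨆ x : V, (Polynomial.aeval (G.adjMatrix ℝ) p) x x

/-- `w(p)`, the smallest diagonal entry of `p(A)`. -/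
noncomputable def minDiag (p : Polynomial ℝ) : ℝ :=
  ⨅ x : V, (Polynomial.aeval (G.adjMatrix ℝ) p) x x

/-- `min { #{i : p(λᵢ) ≥ w(p)}, #{i : p(λᵢ) ≤ W(p)} }`. -/
noncomputable def inertiaCount (p : Polynomial ℝ) : ℕ :=
  min (Nat.card {i : V // minDiag G p ≤ p.eval (adjEigenvalues G i)})
    (Nat.card {i : V // p.eval (adjEigenvalues G i) ≤ maxDiag G p})

end Spectral

/-- A positive tracial functional on a real `*`-algebra, not necessarily normalized. Real values
are enough, since only the real part of a tracial state enters the estimates. -/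
structure IsPositiveTrace {R : Type*} [Ring R] [StarRing R] [Module ℝ R] (τ : R →ₗ[ℝ] ℝ) :
    Prop where
  nonneg : ∀ x : R, 0 ≤ τ (star x * x)
  comm : ∀ x y : R, τ (x * y) = τ (y * x)

theorem IsTracialState.isPositiveTrace_re {A : Type*} [Ring A] [StarRing A] [Algebra ℂ A]
    {τ : A →ₗ[ℂ] ℂ} (hτ : IsTracialState τ) :
    IsPositiveTrace (Complex.reLm ∘ₗ τ.restrictScalars ℝ) where
  nonneg x := (Complex.le_def.1 (hτ.nonneg x)).1
  comm x y := congrArg Complex.re (hτ.comm x y)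

section AlternatingWords

variable {R : Type*} [Ring R] {P F : R}

theorem alternatingWord_mul_mul_eq (hP : IsIdempotentElem P) (hF : IsIdempotentElem F) (m : ℕ) :
    (F * (1 - P)) ^ m * F * P = F * ((P * (1 - F)) ^ m * P) := by
  have intertwine : SemiconjBy (F * P) ((1 - F) * P) (F * (1 - P)) := by
    simp only [SemiconjBy, sub_mul, mul_sub, one_mul, mul_one, ← mul_assoc, hF.eq]
    simp only [mul_assoc, hP.eq]
  rw [mul_assoc, ← (intertwine.pow_right m).eq, mul_assoc, ← mul_pow_mul]

variable {M : Type*} [AddCommGroup M] {τ : R →+ M}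

theorem map_alternatingWord_succ (hτ : ∀ x y, τ (x * y) = τ (y * x)) (hP : IsIdempotentElem P)
    (F : R) (m : ℕ) :
    τ ((P * (1 - F)) ^ (m + 1) * P) =
      τ ((P * (1 - F)) ^ m * P) - τ ((P * (1 - F)) ^ m * P * F) := by
  have word_succ : (P * (1 - F)) ^ (m + 1) * P =
      (P * (1 - F)) ^ m * P - (P * (1 - F)) ^ m * P * F * P := by
    rw [pow_succ, mul_assoc _ _ P, mul_sub, sub_mul, mul_one, hP.eq]
    simp only [mul_sub, mul_assoc]
  have left_absorb : P * ((P * (1 - F)) ^ m * P) = (P * (1 - F)) ^ m * P := by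
    rw [mul_pow_mul, ← mul_assoc, hP.eq]
  rw [word_succ, map_sub, hτ (_ * F), ← mul_assoc, left_absorb]

theorem map_alternatingWord_sub_eq (hτ : ∀ x y, τ (x * y) = τ (y * x))
    (hP : IsIdempotentElem P) (hF : IsIdempotentElem F) (m : ℕ) :
    τ ((F * (1 - P)) ^ m * F) - τ ((P * (1 - F)) ^ m * P) = τ F - τ P := by
  induction m with
  | zero => simp
  | succ m ih =>
    rw [map_alternatingWord_succ hτ hF, map_alternatingWord_succ hτ hP,
      alternatingWord_mul_mul_eq hP hF, hτ F, sub_sub_sub_cancel_right, ih]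

theorem exists_alternatingWord_eq_star_mul_self [StarRing R] (hP : IsStarProjection P)
    (hF : IsStarProjection F) (m : ℕ) : ∃ g, (P * F) ^ m * P = star g * g := by
  induction m generalizing P F with
  | zero => exact ⟨P, by simp [hP.isSelfAdjoint.star_eq, hP.isIdempotentElem.eq]⟩
  | succ m ih =>
    obtain ⟨g, hg⟩ := ih hF hP
    refine ⟨g * P, ?_⟩
    calc (P * F) ^ (m + 1) * P = P * ((F * P) ^ m * F) * P := by
          rw [pow_succ, ← mul_assoc ((P * F) ^ m), mul_pow_mul]
          simp only [mul_assoc]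
      _ = star (g * P) * (g * P) := by
          rw [hg, star_mul, hP.isSelfAdjoint.star_eq]
          simp only [mul_assoc]

end AlternatingWords

namespace IsPositiveTrace

variable {R : Type*} [Ring R] [StarRing R] [Module ℝ R] {τ : R →ₗ[ℝ] ℝ} {P F : R}

theorem alternatingWord_nonneg (hτ : IsPositiveTrace τ) (hP : IsStarProjection P)
    (hF : IsStarProjection F) (m : ℕ) : 0 ≤ τ ((P * F) ^ m * P) := by
  obtain ⟨g, hg⟩ := exists_alternatingWord_eq_star_mul_self hP hF m
  exact hg ▸ hτ.nonneg g

theorem alternatingWord_succ_le (hτ : IsPositiveTrace τ) (hP : IsStarProjection P)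
    (hF : IsStarProjection F) {r : ℝ}
    (hr : ∀ x, P * x = x → τ (star x * F * x) ≤ r * τ (star x * x)) (m : ℕ) :
    τ ((P * F) ^ (m + 1) * P) ≤ r * τ ((P * F) ^ m * P) := by
  obtain ⟨g, hg⟩ := exists_alternatingWord_eq_star_mul_self hP hF m
  have star_mul_eq (y : R) : star (P * star g) * y * (P * star g) = g * (P * y * P) * star g := by
    rw [star_mul, star_star, hP.isSelfAdjoint.star_eq]
    simp only [mul_assoc]
  have map_conj (y : R) : τ (g * y * star g) = τ ((P * F) ^ m * P * y) := by
    rw [hτ.comm, ← mul_assoc, hg]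
  have word_succ : (P * F) ^ m * P * (P * F * P) = (P * F) ^ (m + 1) * P := by
    rw [pow_succ, mul_assoc P F P, ← mul_assoc, mul_assoc _ P P, hP.isIdempotentElem.eq]
    simp only [mul_assoc]
  have hr_g := hr (P * star g) (by rw [← mul_assoc, hP.isIdempotentElem.eq])
  rwa [star_mul_eq, map_conj, word_succ, ← mul_one (star _), star_mul_eq, map_conj, mul_one,
    hP.isIdempotentElem.eq, mul_assoc _ P P, hP.isIdempotentElem.eq] at hr_g

theorem alternatingWord_le_pow (hτ : IsPositiveTrace τ) (hP : IsStarProjection P)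
    (hF : IsStarProjection F) {r : ℝ} (hr₀ : 0 ≤ r)
    (hr : ∀ x, P * x = x → τ (star x * F * x) ≤ r * τ (star x * x)) (m : ℕ) :
    τ ((P * F) ^ m * P) ≤ r ^ m * τ P := by
  induction m with
  | zero => simp
  | succ m ih =>
    calc τ ((P * F) ^ (m + 1) * P) ≤ r * τ ((P * F) ^ m * P) :=
          hτ.alternatingWord_succ_le hP hF hr m
      _ ≤ r * (r ^ m * τ P) := by gcongr
      _ = r ^ (m + 1) * τ P := by ring

/-- The hypothesis makes `x ↦ F * x` injective on the range of `P`, with a bounded inverse. -/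
theorem le_of_forall_le_mul (hτ : IsPositiveTrace τ) (hP : IsStarProjection P)
    (hF : IsStarProjection F) {C : ℝ} (hC : 0 ≤ C)
    (h : ∀ x, P * x = x → τ (star x * (1 - F) * x) ≤ C * τ (star x * F * x)) : τ P ≤ τ F := by
  have compression_le (x : R) (hx : P * x = x) :
      τ (star x * (1 - F) * x) ≤ C / (1 + C) * τ (star x * x) := by
    have pythagoras : τ (star x * x) = τ (star x * F * x) + τ (star x * (1 - F) * x) := by
      rw [← map_add]
      congr 1
      noncomm_ring
    rw [pythagoras, div_mul_eq_mul_div, le_div_iff₀ (by positivity)]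
    linarith [h x hx]
  have gap_le (m : ℕ) : τ P - τ F ≤ (C / (1 + C)) ^ m * τ P := by
    have gap_eq := map_alternatingWord_sub_eq (τ := τ.toAddMonoidHom) hτ.comm
      hP.isIdempotentElem hF.isIdempotentElem m
    simp only [LinearMap.toAddMonoidHom_coe] at gap_eq
    linarith [hτ.alternatingWord_nonneg hF hP.one_sub m,
      hτ.alternatingWord_le_pow hP hF.one_sub (by positivity) compression_le m]
  have decay : Filter.Tendsto (fun m : ℕ ↦ (C / (1 + C)) ^ m * τ P) Filter.atTop (nhds 0) := by
    simpa using (tendsto_pow_atTop_nhds_zero_of_lt_one (by positivity)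
      ((div_lt_one (by positivity)).2 (by linarith))).mul_const (τ P)
  exact sub_nonpos.1 (ge_of_tendsto' decay gap_le)

end IsPositiveTrace

section ScalarMatrices

open Matrix

variable {n : Type*} [Fintype n] [DecidableEq n]

theorem IsPositiveTrace.comp_trace {A : Type*} [Ring A] [StarRing A] [Module ℝ A]
    {τ : A →ₗ[ℝ] ℝ} (hτ : IsPositiveTrace τ) : IsPositiveTrace (τ ∘ₗ traceLinearMap n ℝ A) where
  nonneg X := by
    simp only [LinearMap.comp_apply, traceLinearMap_apply, trace, diag, mul_apply, map_sum]
    exact Finset.sum_nonneg fun x _ ↦ Finset.sum_nonneg fun y _ ↦ hτ.nonneg _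
  comm X Y := by
    simp only [LinearMap.comp_apply, traceLinearMap_apply, trace, diag, mul_apply, map_sum]
    rw [Finset.sum_comm]
    exact Finset.sum_congr rfl fun x _ ↦ Finset.sum_congr rfl fun y _ ↦ hτ.comm _ _

/-- The embedding of scalar matrices into the matrices over a `*`-algebra, entrywise the structure
map. -/
def scalarMatrix (n 𝕜 A : Type*) [Fintype n] [DecidableEq n] [CommRing 𝕜] [StarRing 𝕜] [Ring A]
    [StarRing A] [Algebra 𝕜 A] [StarModule 𝕜 A] : Matrix n n 𝕜 →⋆ₐ[𝕜] Matrix n n A where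
  __ := (Algebra.ofId 𝕜 A).mapMatrix
  map_star' X := by
    ext x y
    exact algebraMap_star_comm (X y x)

theorem scalarMatrix_apply {𝕜 A : Type*} [CommRing 𝕜] [StarRing 𝕜] [Ring A] [StarRing A]
    [Algebra 𝕜 A] [StarModule 𝕜 A] (X : Matrix n n 𝕜) (x y : n) :
    scalarMatrix n 𝕜 A X x y = algebraMap 𝕜 A (X x y) := rfl

theorem diagonal_mul_scalarMatrix_mul_diagonal {𝕜 A : Type*} [CommRing 𝕜] [StarRing 𝕜] [Ring A]
    [StarRing A] [Algebra 𝕜 A] [StarModule 𝕜 A] {q : n → A} {B : Matrix n n 𝕜}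
    (hq : ∀ x y, x ≠ y → B x y ≠ 0 → q x * q y = 0) :
    diagonal q * scalarMatrix n 𝕜 A B * diagonal q =
      diagonal q * scalarMatrix n 𝕜 A (diagonal B.diag) * diagonal q := by
  ext x y
  simp only [mul_diagonal, diagonal_mul, scalarMatrix_apply]
  obtain rfl | hxy := eq_or_ne x y
  · simp
  rw [diagonal_apply_ne _ hxy, map_zero, mul_zero, zero_mul]
  by_cases hB : B x y = 0
  · simp [hB]
  · rw [← Algebra.commutes, mul_assoc, hq x y hxy hB, mul_zero]

theorem isStarProjection_diagonal {A : Type*} [Ring A] [StarRing A] {q : n → A}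
    (hq : ∀ x, IsStarProjection (q x)) : IsStarProjection (diagonal q) where
  isIdempotentElem := by
    simp only [IsIdempotentElem, diagonal_mul_diagonal, (hq _).isIdempotentElem.eq]
  isSelfAdjoint := by
    simp only [IsSelfAdjoint, star_eq_conjTranspose, diagonal_conjTranspose]
    congr 1
    ext x
    exact (hq x).isSelfAdjoint.star_eq

open scoped MatrixOrder Matrix.Norms.L2Operator in
theorem IsPositiveTrace.nonneg_of_posSemidef {A : Type*} [Ring A] [StarRing A] [Algebra ℝ A]
    [StarModule ℝ A] {T : Matrix n n A →ₗ[ℝ] ℝ} (hT : IsPositiveTrace T)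
    {N : Matrix n n ℝ} (hN : N.PosSemidef) (X : Matrix n n A) :
    0 ≤ T (star X * scalarMatrix n ℝ A N * X) := by
  obtain ⟨S, rfl⟩ := CStarAlgebra.nonneg_iff_eq_star_mul_self.1 hN.nonneg
  simpa only [star_mul, map_mul, map_star, mul_assoc] using hT.nonneg (scalarMatrix n ℝ A S * X)

end ScalarMatrices

section SpectralProjection

open Matrix

variable {n : Type*} [Fintype n] [DecidableEq n] {A : Matrix n n ℝ}

theorem trace_cfc_eq_sum (hA : A.IsHermitian) (f : ℝ → ℝ) :
    (cfc f A).trace = ∑ i, f (hA.eigenvalues i) := by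
  rw [hA.cfc_eq, IsHermitian.cfc, Unitary.conjStarAlgAut_apply, trace_mul_cycle]
  simp

/-- The spectral projection of `f(A)` for the interval `[0, ∞)`, as a function of `A` itself, so
that its rank counts the eigenvalues `λ` of `A` with `0 ≤ f λ`. -/
noncomputable def nonnegSpectralProjection (f : ℝ → ℝ) (A : Matrix n n ℝ) : Matrix n n ℝ :=
  cfc (Set.indicator {t | 0 ≤ f t} 1) A

theorem isStarProjection_nonnegSpectralProjection (f : ℝ → ℝ) (A : Matrix n n ℝ) :
    IsStarProjection (nonnegSpectralProjection f A) where
  isIdempotentElem := by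
    have hcont := A.finite_real_spectrum.continuousOn (Set.indicator {t | 0 ≤ f t} (1 : ℝ → ℝ))
    rw [IsIdempotentElem, nonnegSpectralProjection, ← cfc_mul _ _ A hcont hcont]
    congr 1
    ext t
    by_cases ht : 0 ≤ f t <;> simp [ht]
  isSelfAdjoint := cfc_predicate _ A

theorem trace_nonnegSpectralProjection (hA : A.IsHermitian) (f : ℝ → ℝ) :
    (nonnegSpectralProjection f A).trace = Nat.card {i // 0 ≤ f (hA.eigenvalues i)} := by
  classical
  rw [nonnegSpectralProjection, trace_cfc_eq_sum hA, Nat.card_eq_fintype_card,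
    Fintype.card_subtype]
  simp [Set.indicator_apply]

theorem exists_mul_le_and_mul_le_neg_one {ι : Type*} [Finite ι] (μ : ι → ℝ) :
    ∃ ε C : ℝ, 0 ≤ ε ∧ 0 ≤ C ∧ ∀ i, (0 ≤ μ i → ε * μ i ≤ C) ∧ (μ i < 0 → ε * μ i ≤ -1) := by
  obtain ⟨ε, hε⟩ := (Set.finite_range fun i ↦ |μ i|⁻¹).bddAbove
  obtain ⟨C, hC⟩ := (Set.finite_range fun i ↦ max ε 0 * μ i).bddAbove
  refine ⟨max ε 0, max C 0, le_max_right _ _, le_max_right _ _, fun i ↦ ⟨fun _ ↦ ?_, fun hi ↦ ?_⟩⟩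
  · exact le_max_of_le_left (hC ⟨i, rfl⟩)
  · have inv_le : |μ i|⁻¹ ≤ max ε 0 := le_max_of_le_left (hε ⟨i, rfl⟩)
    rw [abs_of_neg hi, inv_le_iff_one_le_mul₀ (neg_pos.2 hi)] at inv_le
    linarith

open scoped MatrixOrder in
theorem exists_posSemidef_smul_nonnegSpectralProjection_sub (hA : A.IsHermitian) (f : ℝ → ℝ) :
    ∃ ε C : ℝ, 0 ≤ ε ∧ 0 ≤ C ∧
      (C • nonnegSpectralProjection f A - (1 - nonnegSpectralProjection f A) -
        ε • cfc f A).PosSemidef := by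
  obtain ⟨ε, C, hε, hC, bound⟩ := exists_mul_le_and_mul_le_neg_one fun i ↦ f (hA.eigenvalues i)
  refine ⟨ε, C, hε, hC, nonneg_iff_posSemidef.1 ?_⟩
  have hcont (g : ℝ → ℝ) : ContinuousOn g (spectrum ℝ A) := A.finite_real_spectrum.continuousOn g
  have hsa : IsSelfAdjoint A := hA
  let χ : ℝ → ℝ := Set.indicator {t | 0 ≤ f t} 1
  have eq_cfc : C • nonnegSpectralProjection f A - (1 - nonnegSpectralProjection f A) -
      ε • cfc f A = cfc (fun t ↦ C * χ t - (1 - χ t) - ε * f t) A := by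
    rw [cfc_sub _ _ A (hcont _) (hcont _), cfc_sub _ _ A (hcont _) (hcont _),
      cfc_const_mul _ _ A (hcont _), cfc_const_mul _ _ A (hcont _),
      cfc_sub _ _ A (hcont _) (hcont _), cfc_const_one ℝ A]
    rfl
  rw [eq_cfc]
  refine cfc_nonneg fun t ht ↦ ?_
  obtain ⟨i, rfl⟩ := hA.spectrum_real_eq_range_eigenvalues ▸ ht
  by_cases hi : 0 ≤ f (hA.eigenvalues i)
  · simpa [χ, hi] using (bound i).1 hi
  · have := (bound i).2 (not_le.1 hi)
    simp only [χ, Set.indicator_of_notMem (show hA.eigenvalues i ∉ {t | 0 ≤ f t} from hi)]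
    linarith

theorem IsPositiveTrace.sum_le_card_nonneg {𝒜 : Type*} [Ring 𝒜] [StarRing 𝒜] [Algebra ℝ 𝒜]
    [StarModule ℝ 𝒜] {τ : 𝒜 →ₗ[ℝ] ℝ} (hτ : IsPositiveTrace τ) (hτ_one : τ 1 = 1)
    (hA : A.IsHermitian) {f : ℝ → ℝ} (hdiag : ∀ x, 0 ≤ cfc f A x x) {q : n → 𝒜}
    (hq : ∀ x, IsStarProjection (q x))
    (horth : ∀ x y, x ≠ y → cfc f A x y ≠ 0 → q x * q y = 0) :
    ∑ x, τ (q x) ≤ Nat.card {i // 0 ≤ f (hA.eigenvalues i)} := by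
  let T : Matrix n n 𝒜 →ₗ[ℝ] ℝ := τ ∘ₗ traceLinearMap n ℝ 𝒜
  let ι := scalarMatrix n ℝ 𝒜
  let F := nonnegSpectralProjection f A
  have hT : IsPositiveTrace T := hτ.comp_trace
  have hP : IsStarProjection (diagonal q) := isStarProjection_diagonal hq
  have hF : IsStarProjection (ι F) := (isStarProjection_nonnegSpectralProjection f A).map ι
  have form_nonneg (X : Matrix n n 𝒜) (hX : diagonal q * X = X) :
      0 ≤ T (star X * ι (cfc f A) * X) := by
    have compress (N : Matrix n n 𝒜) :
        star X * N * X = star X * (diagonal q * N * diagonal q) * X := by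
      conv_lhs => rw [← hX, star_mul, hP.isSelfAdjoint.star_eq]
      simp only [mul_assoc]
    rw [compress, diagonal_mul_scalarMatrix_mul_diagonal horth, ← compress]
    exact hT.nonneg_of_posSemidef (.diagonal hdiag) X
  obtain ⟨ε, C, hε, hC, hpos⟩ := exists_posSemidef_smul_nonnegSpectralProjection_sub hA f
  have le_F : T (diagonal q) ≤ T (ι F) := by
    refine hT.le_of_forall_le_mul hP hF hC fun X hX ↦ ?_
    have := hT.nonneg_of_posSemidef hpos X
    simp only [map_sub, map_smul, map_one, mul_sub, sub_mul, mul_smul_comm, smul_mul_assoc,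
      smul_eq_mul] at this ⊢
    linarith [mul_nonneg hε (form_nonneg X hX)]
  calc ∑ x, τ (q x) = T (diagonal q) := by simp [T]
    _ ≤ T (ι F) := le_F
    _ = F.trace := by
      simp [T, ι, trace, scalarMatrix_apply, Algebra.algebraMap_eq_smul_one, hτ_one]
    _ = Nat.card {i // 0 ≤ f (hA.eigenvalues i)} := trace_nonnegSpectralProjection hA f

theorem IsPositiveTrace.card_le_mul_card_nonneg {𝒜 : Type*} [Ring 𝒜] [StarRing 𝒜] [Algebra ℝ 𝒜]
    [StarModule ℝ 𝒜] {τ : 𝒜 →ₗ[ℝ] ℝ} (hτ : IsPositiveTrace τ) (hτ_one : τ 1 = 1)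
    (hA : A.IsHermitian) {f : ℝ → ℝ} (hdiag : ∀ x, 0 ≤ cfc f A x x) {ι : Type*} [Fintype ι]
    {q : n → ι → 𝒜} (hq : ∀ x h, IsStarProjection (q x h)) (hsum : ∀ x, ∑ h, q x h = 1)
    (horth : ∀ x y, x ≠ y → cfc f A x y ≠ 0 → ∀ h, q x h * q y h = 0) :
    Fintype.card n ≤ Fintype.card ι * Nat.card {i // 0 ≤ f (hA.eigenvalues i)} := by
  have card_le : (Fintype.card n : ℝ) ≤
      Fintype.card ι * Nat.card {i // 0 ≤ f (hA.eigenvalues i)} :=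
    calc (Fintype.card n : ℝ) = ∑ x, ∑ h, τ (q x h) := by simp [← map_sum, hsum, hτ_one]
      _ = ∑ h, ∑ x, τ (q x h) := Finset.sum_comm
      _ ≤ ∑ _h : ι, (Nat.card {i // 0 ≤ f (hA.eigenvalues i)} : ℝ) :=
        Finset.sum_le_sum fun h _ ↦ hτ.sum_le_card_nonneg hτ_one hA hdiag (fun x ↦ hq x h)
          fun x y hxy hne ↦ horth x y hxy hne h
      _ = Fintype.card ι * Nat.card {i // 0 ≤ f (hA.eigenvalues i)} := by simp
  exact_mod_cast card_le

end SpectralProjection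

section DistColoring

variable {V : Type v} {G : SimpleGraph V} {k c : ℕ}

theorem edist_le_of_aeval_adjMatrix_ne_zero {α : Type*} [CommSemiring α] [Fintype V]
    [DecidableEq V] [DecidableRel G.Adj] {p : Polynomial α} (hp : p.natDegree ≤ k) {x y : V}
    (h : Polynomial.aeval (G.adjMatrix α) p x y ≠ 0) : G.edist x y ≤ k := by
  rw [Polynomial.aeval_eq_sum_range, Matrix.sum_apply] at h
  obtain ⟨m, hm, hcoeff⟩ := Finset.exists_ne_zero_of_sum_ne_zero h
  rw [Matrix.smul_apply, SimpleGraph.adjMatrix_pow_apply_eq_card_walk, smul_eq_mul] at hcoeff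
  have card_ne_zero : Fintype.card {w : G.Walk x y | w.length = m} ≠ 0 :=
    fun h₀ ↦ hcoeff (by simp [h₀])
  obtain ⟨w, hw : w.length = m⟩ := Fintype.card_pos_iff.1 (Nat.pos_of_ne_zero card_ne_zero)
  have m_le : m ≤ k := (Nat.lt_succ_iff.1 (Finset.mem_range.1 hm)).trans hp
  exact w.edist_le.trans (by exact_mod_cast hw.trans_le m_le)

namespace IsQuantumDistColoring

variable [Fintype V] [DecidableEq V] [DecidableRel G.Adj] {H : Type u} [NormedAddCommGroup H]
  [InnerProductSpace ℂ H] [CompleteSpace H] {P : V → Fin c → (H →L[ℂ] H)} {p : Polynomial ℝ}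

theorem card_le_mul_card_nonneg (hP : IsQuantumDistColoring G k c P) (hp : p.natDegree ≤ k)
    (hdiag : ∀ x, 0 ≤ Polynomial.aeval (G.adjMatrix ℝ) p x x) :
    Fintype.card V ≤ c * Nat.card {i // 0 ≤ p.eval (adjEigenvalues G i)} := by
  obtain ⟨τ, hτ⟩ := hP.tracial
  have hA : (G.adjMatrix ℝ).IsHermitian :=
    (Matrix.conjTranspose_eq_transpose_of_trivial _).trans G.transpose_adjMatrix
  have cfc_eq : cfc p.eval (G.adjMatrix ℝ) = Polynomial.aeval (G.adjMatrix ℝ) p :=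
    cfc_polynomial p _ hA
  let q (x : V) (h : Fin c) : StarAlgebra.adjoin ℂ {T : H →L[ℂ] H | ∃ x h, T = P x h} :=
    ⟨P x h, StarAlgebra.subset_adjoin ℂ _ ⟨x, h, rfl⟩⟩
  have q_proj (x : V) (h : Fin c) : IsStarProjection (q x h) :=
    ⟨Subtype.ext (hP.proj x h).isIdempotentElem, Subtype.ext (hP.proj x h).isSelfAdjoint⟩
  have q_complete (x : V) : ∑ h, q x h = 1 := Subtype.ext (by simpa [q] using hP.complete x)
  have q_orthogonal (x y : V) (hxy : x ≠ y) (hne : cfc p.eval (G.adjMatrix ℝ) x y ≠ 0)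
      (h : Fin c) : q x h * q y h = 0 :=
    Subtype.ext (hP.orthogonal x y hxy (edist_le_of_aeval_adjMatrix_ne_zero hp (cfc_eq ▸ hne)) h)
  have card_le := hτ.isPositiveTrace_re.card_le_mul_card_nonneg (congrArg Complex.re hτ.map_one)
    hA (f := p.eval) (by rwa [cfc_eq]) q_proj q_complete q_orthogonal
  rwa [Fintype.card_fin] at card_le

theorem card_le_mul_inertiaCount (hP : IsQuantumDistColoring G k c P) (hp : p.natDegree ≤ k) :
    Fintype.card V ≤ c * inertiaCount G p := by
  have aeval_C (r : ℝ) (x : V) : Polynomial.aeval (G.adjMatrix ℝ) (Polynomial.C r) x x = r := by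
    simp [Matrix.algebraMap_matrix_apply]
  have minDiag_le (x : V) : minDiag G p ≤ Polynomial.aeval (G.adjMatrix ℝ) p x x :=
    ciInf_le (Set.finite_range _).bddBelow x
  have le_maxDiag (x : V) : Polynomial.aeval (G.adjMatrix ℝ) p x x ≤ maxDiag G p :=
    le_ciSup (f := fun x ↦ Polynomial.aeval (G.adjMatrix ℝ) p x x) (Set.finite_range _).bddAbove x
  have card_le_of_min := hP.card_le_mul_card_nonneg (p := p - Polynomial.C (minDiag G p))
    (Polynomial.natDegree_sub_C.trans_le hp) fun x ↦ by
      rw [map_sub, Matrix.sub_apply, aeval_C]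
      exact sub_nonneg.2 (minDiag_le x)
  have card_le_of_max := hP.card_le_mul_card_nonneg (p := Polynomial.C (maxDiag G p) - p)
    (Polynomial.natDegree_sub.trans_le (Polynomial.natDegree_sub_C.trans_le hp)) fun x ↦ by
      rw [map_sub, Matrix.sub_apply, aeval_C]
      exact sub_nonneg.2 (le_maxDiag x)
  simp only [Polynomial.eval_sub, Polynomial.eval_C, sub_nonneg] at card_le_of_min card_le_of_max
  rw [inertiaCount, ← Nat.mul_min_mul_left]
  exact le_min card_le_of_min card_le_of_max

end IsQuantumDistColoring

/-- The vector state `T ↦ ⟪e, T e⟫` on a star subalgebra of bounded operators, used as a trace on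
a commutative one. -/
noncomputable def vectorState {H : Type*} [NormedAddCommGroup H] [InnerProductSpace ℂ H]
    [CompleteSpace H] (S : StarSubalgebra ℂ (H →L[ℂ] H)) (e : H) : S →ₗ[ℂ] ℂ where
  toFun T := inner ℂ e ((T : H →L[ℂ] H) e)
  map_add' T T' := by simp
  map_smul' a T := by simp

theorem isTracialState_vectorState {H : Type*} [NormedAddCommGroup H] [InnerProductSpace ℂ H]
    [CompleteSpace H] {S : StarSubalgebra ℂ (H →L[ℂ] H)} (hS : ∀ x y : S, x * y = y * x)
    {e : H} (he : ‖e‖ = 1) : IsTracialState (vectorState S e) where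
  map_one := by simp [vectorState, he]
  nonneg x := by
    have : vectorState S e (star x * x) = (‖(x : H →L[ℂ] H) e‖ ^ 2 : ℝ) := by
      simp [vectorState, ContinuousLinearMap.star_eq_adjoint,
        ContinuousLinearMap.adjoint_inner_right]
    rw [this]
    exact_mod_cast sq_nonneg ‖(x : H →L[ℂ] H) e‖
  comm x y := by rw [hS]

theorem hasQuantumDistColoring_of_distColoring (f : V → Fin c)
    (hf : ∀ x y, x ≠ y → G.edist x y ≤ k → f x ≠ f y) : HasQuantumDistColoring.{u} G k c := by
  let H := EuclideanSpace ℂ PUnit.{u + 1}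
  let P (x : V) (h : Fin c) : H →L[ℂ] H := if f x = h then 1 else 0
  refine ⟨H, inferInstance, inferInstance, inferInstance, P, ?_, ?_, ?_, ?_⟩
  · intro x h
    by_cases hx : f x = h
    · simp [P, hx, IsStarProjection.one]
    · simp [P, hx, IsStarProjection.zero]
  · simp [P]
  · intro x y hxy hdist h
    by_cases hx : f x = h
    · simp [P, (hx ▸ hf x y hxy hdist).symm]
    · simp [P, hx]
  · have P_central (x : V) (h : Fin c) (T : H →L[ℂ] H) : P x h * T = T * P x h := by
      by_cases hx : f x = h <;> simp [P, hx]
    have adjoin_comm : IsMulCommutative (StarAlgebra.adjoin ℂ {T : H →L[ℂ] H | ∃ x h, T = P x h}) :=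
      StarAlgebra.isMulCommutative_adjoin ℂ
        (by rintro _ ⟨x, h, rfl⟩ T -; exact P_central x h T)
        (by rintro _ ⟨x, h, rfl⟩ T -; exact P_central x h (star T))
    exact ⟨_, isTracialState_vectorState adjoin_comm.is_comm.comm
      ((PiLp.norm_single 2 (fun _ ↦ ℂ) PUnit.unit 1).trans norm_one)⟩

theorem hasQuantumDistColoring_card [Fintype V] (G : SimpleGraph V) (k : ℕ) :
    HasQuantumDistColoring.{u} G k (Fintype.card V) :=
  hasQuantumDistColoring_of_distColoring (Fintype.equivFin V) fun _ _ hxy _ ↦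
    (Fintype.equivFin V).injective.ne hxy

end DistColoring

theorem mainTheorem6 {V : Type v} [Fintype V] [DecidableEq V] [Nonempty V]
    (G : SimpleGraph V) [DecidableRel G.Adj] (k : ℕ) (hk : 0 < k)
    (p : Polynomial ℝ) (hp : p.natDegree ≤ k) :
    0 < inertiaCount G p ∧
      (Fintype.card V : ℝ) / (inertiaCount G p : ℝ) ≤
        (quantumDistChromaticNumber.{u} G k : ℝ) := by
  obtain ⟨H, _, _, _, P, hP⟩ :
      HasQuantumDistColoring.{u} G k (quantumDistChromaticNumber.{u} G k) :=
    Nat.sInf_mem (s := {c | HasQuantumDistColoring.{u} G k c}) ⟨_, hasQuantumDistColoring_card G k⟩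
  have card_le : Fintype.card V ≤ quantumDistChromaticNumber.{u} G k * inertiaCount G p :=
    hP.card_le_mul_inertiaCount hp
  have inertia_pos : 0 < inertiaCount G p :=
    Nat.pos_of_mul_pos_left (Fintype.card_pos.trans_le card_le)
  exact ⟨inertia_pos, (div_le_iff₀ (by exact_mod_cast inertia_pos)).2 (by exact_mod_cast card_le)⟩
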